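/- Let $\mathbb T$ be the unit circle, let $\mu$ be the normalized Haar measure on $\mathbb T^{\mathbb N}$, and let $(z_n)_{n\in\mathbb N}$ be the sequence of coordinate functions on $\mathbb T^{\mathbb N}$. Let $(T,m)$ be a probability space; all function spaces are over $\mathbb C$. Let $(f_n)_{n\in\mathbb N}$ be a sequence in $L_1(T,m)$ that is dominated by $(z_n)$, i.e. there is a bounded linear map $u:L_1(\mathbb T^{\mathbb N},\mu)\to L_1(T,m)$ such that $u(z_n)=f_n$ for all $n$. Let $(\psi_n)_{n\in\mathbb N}$ be a sequence in $L_\infty(T,m)$ that is uniformly bounded, i.e. $\sup_n\|\psi_n\|_\infty<\infty$, and biorthogonal to $(f_n)$, i.e. $$\int_T \psi_n f_k\,dm=\delta_{nk}\qquad\text{for all } n,k.$$ Then $(\psi_n)$ is $\otimes^2$-Sidon: there is a constant $C$ such that for every finitely supported sequence $(x_n)$ of complex numbers $$\sum_n |x_n|\le C\,\Big\|\sum_n x_n\,\psi_n\otimes\psi_n\Big\|_{L_\infty(T\times T,\,m\times m)},$$ where $(\psi_n\otimes\psi_n)(t_1,t_2)=\psi_n(t_1)\psi_n(t_2)$. 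-/

import Mathlib

open MeasureTheory

/-- The period `2π` is positive; this makes `ℝ / 2πℤ` a compact group. -/
instance fact_two_pi_pos : Fact (0 < 2 * Real.pi) :=
  ⟨Real.two_pi_pos⟩

/-- The infinite-dimensional torus `𝕋^ℕ`, where `𝕋 = ℝ / 2πℤ`. -/
abbrev InfTorus : Type := ℕ → AddCircle (2 * Real.pi)

/-- The normalized Haar measure on the compact group `𝕋^ℕ`. -/
noncomputable def torusHaar : Measure InfTorus :=
  Measure.addHaarMeasure ⊤

/-- The total mass of `torusHaar` is one. -/
instance isProbabilityMeasure_torusHaar : IsProbabilityMeasure torusHaar :=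
  ⟨Measure.addHaarMeasure_self (K₀ := (⊤ : TopologicalSpace.PositiveCompacts InfTorus))⟩

/-- The measure `torusHaar` is invariant under translations. -/
instance isAddHaarMeasure_torusHaar : Measure.IsAddHaarMeasure torusHaar := by
  unfold torusHaar
  infer_instance

/-- The `n`-th coordinate function `θ ↦ exp (i θ_n)` on `𝕋^ℕ`, with values in the unit circle. -/
noncomputable def torusCoordinate (n : ℕ) (θ : InfTorus) : ℂ :=
  (AddCircle.toCircle (θ n) : ℂ)

/-- The coordinate functions on `𝕋^ℕ` are integrable. -/
theorem memLp_torusCoordinate (n : ℕ) : MemLp (torusCoordinate n) 1 torusHaar := by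
  have hc : Continuous (torusCoordinate n) :=
    continuous_subtype_val.comp (AddCircle.continuous_toCircle.comp (continuous_apply n))
  exact MemLp.of_bound hc.aestronglyMeasurable 1
    (Filter.Eventually.of_forall fun θ => (Circle.norm_coe _).le)

/-- The Steinhaus sequence `(z_n)`: the coordinate functions on `𝕋^ℕ`, as elements
of `L_1(𝕋^ℕ, μ)` for the normalized Haar measure `μ`. -/
noncomputable def steinhaus (n : ℕ) : Lp ℂ 1 torusHaar :=
  (memLp_torusCoordinate n).toLp (torusCoordinate n)

/-- The family `f` in `L_1(m'')` is `c`-dominated by the family `g` in `L_1(m')`: there is a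
bounded linear map `u : L_1(m') → L_1(m'')` with `‖u‖ ≤ c` and `u (g n) = f n` for all `n`. -/
def IsDominatedWith {I S' S'' : Type*} [MeasurableSpace S'] [MeasurableSpace S'']
    {m' : Measure S'} {m'' : Measure S''} (c : ℝ)
    (f : I → Lp ℂ 1 m'') (g : I → Lp ℂ 1 m') : Prop :=
  ∃ u : Lp ℂ 1 m' →L[ℂ] Lp ℂ 1 m'', ‖u‖ ≤ c ∧ ∀ n, u (g n) = f n

/-- The family `f` is dominated by the family `g`: it is `c`-dominated for some constant `c`. -/
def IsDominated {I S' S'' : Type*} [MeasurableSpace S'] [MeasurableSpace S'']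
    {m' : Measure S'} {m'' : Measure S''}
    (f : I → Lp ℂ 1 m'') (g : I → Lp ℂ 1 m') : Prop :=
  ∃ c : ℝ, IsDominatedWith c f g

/-- A family `φ` in `L_∞(m)` is Sidon if there is a constant `C` such that
`∑ |x n| ≤ C ‖∑ x n φ n‖_∞` for every finitely supported scalar family `x`. -/
def IsSidon {I S : Type*} [MeasurableSpace S] {m : Measure S} (φ : I → Lp ℂ ⊤ m) : Prop :=
  ∃ C : ℝ, ∀ x : I →₀ ℂ,
    ∑ n ∈ x.support, ‖x n‖ ≤ C * ‖∑ n ∈ x.support, x n • φ n‖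

/-- The function `(t₁, t₂) ↦ f t₁ * f t₂` belongs to `L_∞(m × m)` if `f` belongs to `L_∞(m)`. -/
theorem memLp_tensorSquare {S : Type*} [MeasurableSpace S] {m : Measure S}
    [IsProbabilityMeasure m] (f : Lp ℂ ⊤ m) :
    MemLp (fun t : S × S => f t.1 * f t.2) ⊤ (m.prod m) := by
  have h1 : MemLp (fun t : S × S => f t.1) ⊤ (m.prod m) :=
    (Lp.memLp f).comp_measurePreserving measurePreserving_fst
  have h2 : MemLp (fun t : S × S => f t.2) ⊤ (m.prod m) :=
    (Lp.memLp f).comp_measurePreserving measurePreserving_snd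
  exact h2.mul h1

/-- The tensor square `f ⊗ f`, i.e. `(t₁, t₂) ↦ f t₁ * f t₂`, as an element of `L_∞(m × m)`. -/
noncomputable def tensorSquare {S : Type*} [MeasurableSpace S] {m : Measure S}
    [IsProbabilityMeasure m] (f : Lp ℂ ⊤ m) : Lp ℂ ⊤ (m.prod m) :=
  (memLp_tensorSquare f).toLp _

/-- A family `φ` in `L_∞(m)` is `⊗²-Sidon` if the family `φ n ⊗ φ n` in `L_∞(m × m)` is Sidon. -/
def IsTensorSquareSidon {I S : Type*} [MeasurableSpace S] {m : Measure S}
    [IsProbabilityMeasure m] (φ : I → Lp ℂ ⊤ m) : Prop :=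
  IsSidon fun n => tensorSquare (φ n)

/-- The sequences `ψ` in `L_∞(m)` and `f` in `L_1(m)` are biorthogonal for the bilinear pairing:
`∫ ψ n * f k dm` is `1` if `n = k` and `0` otherwise. -/
def IsBiorthogonal {I S : Type*} [MeasurableSpace S] {m : Measure S}
    (ψ : I → Lp ℂ ⊤ m) (f : I → Lp ℂ 1 m) : Prop :=
  (∀ n, ∫ t, ψ n t * f n t ∂m = 1) ∧ ∀ n k, n ≠ k → ∫ t, ψ n t * f k t ∂m = 0

/-! The sum `Φ = ∑ x_n ψ_n ⊗ ψ_n` is tested against a kernel in `L_1(m × m)`. Choose phases `c_n`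
with `x_n c_n = |x_n|`. Averaged Riesz products give a trigonometric polynomial `ν = ∑ a_p z^p` with
`‖ν‖_1 ≤ ρ⁻¹`, whose coefficient is `c_n` at each `z_n` and at most `ρ` in modulus at every other
character. The kernel `ν(t + x) = ∑ a_p z^p(t) z^p(x)` has the same `L_1` norm by invariance.
Applying `u` in each variable costs a factor `‖u‖²`.

Pairing the image kernel with `Φ` gives `∑ x_n ∑_p a_p ⟨ψ_n, u z^p⟩²`. By biorthogonality the
characters `z_k` contribute exactly `c_n` to the inner sum. The rest is at most `ρ ∑_p |⟨ψ_n, u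
z^p⟩|²`. The functional `⟨ψ_n, u ·⟩` on `L_1` is bounded by `M = K ‖u‖`, so Bessel's inequality
bounds the rest by `ρ M² ≤ 1/2`. Half of `∑ |x_n|` therefore survives. -/

/-! ### Characters of the infinite torus -/

/-- The character `θ ↦ ∏ n ∈ S, exp (i q_n θ_n)` of the infinite torus. -/
noncomputable def torusMonomial {S : Finset ℕ} (q : S → ℤ) (θ : InfTorus) : Circle :=
  ∏ n : S, AddCircle.toCircle (θ n) ^ q n

theorem torusMonomial_add {S : Finset ℕ} (q : S → ℤ) (θ η : InfTorus) :
    torusMonomial q (θ + η) = torusMonomial q θ * torusMonomial q η := by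
  simp [torusMonomial, AddCircle.toCircle_add, mul_zpow, Finset.prod_mul_distrib]

theorem torusMonomial_sub {S : Finset ℕ} (p q : S → ℤ) (θ : InfTorus) :
    torusMonomial (p - q) θ = torusMonomial p θ / torusMonomial q θ := by
  simp [torusMonomial, zpow_sub, div_eq_mul_inv, Finset.prod_mul_distrib]

theorem torusMonomial_single {S : Finset ℕ} (n : S) (θ : InfTorus) :
    torusMonomial (Pi.single n 1) θ = AddCircle.toCircle (θ n) := by
  rw [torusMonomial, Finset.prod_eq_single n]
  · simp
  · intro k _ hk
    simp [hk]
  · simp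

theorem continuous_torusMonomial {S : Finset ℕ} (q : S → ℤ) :
    Continuous fun θ => (torusMonomial q θ : ℂ) := by
  have : Continuous fun θ : InfTorus => torusMonomial q θ := by
    unfold torusMonomial
    refine continuous_finsetProd _ fun n _ => ?_
    exact (AddCircle.continuous_toCircle.comp (continuous_apply (n : ℕ))).zpow _
  exact continuous_subtype_val.comp this

theorem memLp_torusMonomial {S : Finset ℕ} (q : S → ℤ) :
    MemLp (fun θ => (torusMonomial q θ : ℂ)) 1 torusHaar :=
  MemLp.of_bound (continuous_torusMonomial q).aestronglyMeasurable 1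
    (Filter.Eventually.of_forall fun _ => (Circle.norm_coe _).le)

theorem integral_torusMonomial_eq_zero {S : Finset ℕ} {q : S → ℤ} (hq : q ≠ 0) :
    ∫ θ, (torusMonomial q θ : ℂ) ∂torusHaar = 0 := by
  obtain ⟨n, hn⟩ := Function.ne_iff.1 hq
  have hn' : (q n : ℝ) ≠ 0 := by exact_mod_cast hn
  -- Translation by `η` multiplies the character by `exp (iπ) = -1`, so invariance forces its
  -- integral to vanish.
  let η : InfTorus := Pi.single (n : ℕ) ((Real.pi / q n : ℝ) : AddCircle (2 * Real.pi))
  have hη : torusMonomial q η = Circle.exp Real.pi := by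
    rw [torusMonomial, Finset.prod_eq_single n]
    · have : η n = ((Real.pi / q n : ℝ) : AddCircle (2 * Real.pi)) := by simp [η]
      rw [this, AddCircle.toCircle_apply_mk, ← Circle.exp_zsmul]
      congr 1
      simp only [zsmul_eq_mul]
      field_simp
    · intro k _ hk
      have : η k = 0 := by
        simp only [η]
        rw [Pi.single_eq_of_ne]
        exact fun h => hk (Subtype.ext h)
      simp [this, AddCircle.toCircle_zero]
    · simp
  have h := integral_add_right_eq_self (μ := torusHaar)
    (fun θ => (torusMonomial q θ : ℂ)) η
  simp only [torusMonomial_add, hη, Circle.coe_mul, Circle.coe_exp, Complex.exp_pi_mul_I,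
    mul_neg, mul_one, integral_neg] at h
  have h2 : (2 : ℂ) * ∫ θ, (torusMonomial q θ : ℂ) ∂torusHaar = 0 := by linear_combination -h
  simpa using h2

theorem integral_torusMonomial {S : Finset ℕ} (q : S → ℤ) :
    ∫ θ, (torusMonomial q θ : ℂ) ∂torusHaar = if q = 0 then 1 else 0 := by
  split_ifs with h
  · simp [h, torusMonomial]
  · exact integral_torusMonomial_eq_zero h

/-- Trigonometric monomials as elements of `L_1`. -/
noncomputable def torusMonomialLp {S : Finset ℕ} (q : S → ℤ) : Lp ℂ 1 torusHaar :=
  (memLp_torusMonomial q).toLp _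

theorem torusMonomialLp_single {S : Finset ℕ} (n : S) :
    torusMonomialLp (Pi.single n 1) = steinhaus n := by
  unfold torusMonomialLp steinhaus
  congr 1
  funext θ
  rw [torusMonomial_single, torusCoordinate]

theorem coeFn_torusMonomialLp {S : Finset ℕ} (q : S → ℤ) :
    torusMonomialLp q =ᵐ[torusHaar] fun θ => (torusMonomial q θ : ℂ) :=
  (memLp_torusMonomial q).coeFn_toLp

/-! ### `L_1` norms of finite sums, and Bessel's inequality -/

theorem coeFn_sum_smul {I α : Type*} [MeasurableSpace α] {μ : Measure α} {r : ENNReal}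
    (s : Finset I) (a : I → ℂ) (e : I → Lp ℂ r μ) :
    (∑ i ∈ s, a i • e i : Lp ℂ r μ) =ᵐ[μ] fun x => ∑ i ∈ s, a i * e i x := by
  classical
  induction s using Finset.induction_on with
  | empty => exact Lp.coeFn_zero ℂ r μ
  | insert i s hi ih =>
    rw [Finset.sum_insert hi]
    filter_upwards [Lp.coeFn_add (a i • e i) (∑ i ∈ s, a i • e i), ih,
      Lp.coeFn_smul (a i) (e i)] with x h1 h2 h3
    rw [h1, Pi.add_apply, h2, h3, Finset.sum_insert hi, Pi.smul_apply, smul_eq_mul]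

theorem norm_sum_smul_eq_integral {I α : Type*} [MeasurableSpace α] {μ : Measure α}
    (s : Finset I) (a : I → ℂ) (e : I → Lp ℂ 1 μ) :
    ‖∑ i ∈ s, a i • e i‖ = ∫ x, ‖∑ i ∈ s, a i * e i x‖ ∂μ := by
  rw [L1.norm_eq_integral_norm]
  exact integral_congr_ae ((coeFn_sum_smul s a e).mono fun x hx => by simp only [hx])

theorem norm_sum_smul_torusMonomialLp {S : Finset ℕ} (P : Finset (S → ℤ)) (a : (S → ℤ) → ℂ) :
    ‖∑ p ∈ P, a p • torusMonomialLp p‖ =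
      ∫ θ, ‖∑ p ∈ P, a p * (torusMonomial p θ : ℂ)‖ ∂torusHaar := by
  rw [norm_sum_smul_eq_integral]
  refine integral_congr_ae ?_
  have : ∀ᵐ θ ∂torusHaar, ∀ p ∈ P, torusMonomialLp p θ = (torusMonomial p θ : ℂ) :=
    (Filter.eventually_all_finset P).2 fun p _ => coeFn_torusMonomialLp p
  filter_upwards [this] with θ hθ
  congr 1
  exact Finset.sum_congr rfl fun p hp => by rw [hθ p hp]

theorem integral_normSq_sum_torusMonomial {S : Finset ℕ} (P : Finset (S → ℤ))
    (a : (S → ℤ) → ℂ) :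
    ∫ θ, ‖∑ p ∈ P, a p * (torusMonomial p θ : ℂ)‖ ^ 2 ∂torusHaar = ∑ p ∈ P, ‖a p‖ ^ 2 := by
  have key : ∀ θ, ((‖∑ p ∈ P, a p * (torusMonomial p θ : ℂ)‖ ^ 2 : ℝ) : ℂ) =
      ∑ p ∈ P, ∑ q ∈ P, (a p * star (a q)) * (torusMonomial (p - q) θ : ℂ) := by
    intro θ
    push_cast
    rw [← Complex.mul_conj', map_sum, Finset.sum_mul_sum]
    refine Finset.sum_congr rfl fun p _ => Finset.sum_congr rfl fun q _ => ?_
    rw [torusMonomial_sub, div_eq_mul_inv, Circle.coe_mul, Circle.coe_inv_eq_conj, map_mul]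
    simp only [RCLike.star_def]
    ring
  have hint : ∀ q : S → ℤ, Integrable (fun θ => (torusMonomial q θ : ℂ)) torusHaar :=
    fun q => memLp_one_iff_integrable.1 (memLp_torusMonomial q)
  have h : ((∫ θ, ‖∑ p ∈ P, a p * (torusMonomial p θ : ℂ)‖ ^ 2 ∂torusHaar : ℝ) : ℂ) =
      ((∑ p ∈ P, ‖a p‖ ^ 2 : ℝ) : ℂ) := by
    rw [← integral_complex_ofReal]
    simp_rw [key]
    rw [integral_finsetSum _ fun p _ => integrable_finsetSum _ fun q _ => (hint _).const_mul _]
    push_cast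
    refine Finset.sum_congr rfl fun p hp => ?_
    rw [integral_finsetSum _ fun q _ => (hint _).const_mul _]
    simp_rw [integral_const_mul, integral_torusMonomial, sub_eq_zero]
    simp only [mul_ite, mul_one, mul_zero, Finset.sum_ite_eq, hp, if_true]
    exact Complex.mul_conj' _
  exact_mod_cast h

/-- Bessel's inequality for a functional which is bounded on `L_1`. -/
theorem sum_normSq_apply_torusMonomialLp_le {S : Finset ℕ} (P : Finset (S → ℤ))
    (Ψ : Lp ℂ 1 torusHaar →ₗ[ℂ] ℂ) {M : ℝ} (hΨ : ∀ g, ‖Ψ g‖ ≤ M * ‖g‖) :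
    ∑ p ∈ P, ‖Ψ (torusMonomialLp p)‖ ^ 2 ≤ M ^ 2 := by
  -- Conjugate weights turn the value of `Ψ` on the sum into `A`, which is also the squared `L_2`
  -- norm of the sum.
  set w : (S → ℤ) → ℂ := fun p => star (Ψ (torusMonomialLp p)) with hw
  set A := ∑ p ∈ P, ‖Ψ (torusMonomialLp p)‖ ^ 2 with hA
  have h1 : Ψ (∑ p ∈ P, w p • torusMonomialLp p) = (A : ℂ) := by
    rw [map_sum, hA]
    push_cast
    refine Finset.sum_congr rfl fun p _ => ?_
    rw [map_smul, smul_eq_mul]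
    exact Complex.conj_mul' _
  have h2 := hΨ (∑ p ∈ P, w p • torusMonomialLp p)
  rw [h1, norm_sum_smul_torusMonomialLp, Complex.norm_real, ← integral_const_mul] at h2
  have hc : Continuous fun θ => ∑ p ∈ P, w p * (torusMonomial p θ : ℂ) :=
    continuous_finsetSum _ fun p _ => continuous_const.mul (continuous_torusMonomial p)
  have h3 : ∫ θ, M * ‖∑ p ∈ P, w p * (torusMonomial p θ : ℂ)‖ ∂torusHaar ≤
      ∫ θ, (‖∑ p ∈ P, w p * (torusMonomial p θ : ℂ)‖ ^ 2 + M ^ 2) / 2 ∂torusHaar := by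
    refine integral_mono ?_ ?_ fun θ => ?_
    · exact (hc.norm.const_mul M).integrable_of_hasCompactSupport (HasCompactSupport.of_compactSpace _)
    · exact (((hc.norm.pow 2).add continuous_const).div_const 2).integrable_of_hasCompactSupport
        (HasCompactSupport.of_compactSpace _)
    · dsimp only
      -- `M s ≤ (s² + M²) / 2` replaces the Cauchy–Schwarz inequality and leaves `A ≤ (A + M²) / 2`.
      nlinarith [sq_nonneg (‖∑ p ∈ P, w p * (torusMonomial p θ : ℂ)‖ - M)]
  have h4 : ∫ θ, (‖∑ p ∈ P, w p * (torusMonomial p θ : ℂ)‖ ^ 2 + M ^ 2) / 2 ∂torusHaar =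
      (A + M ^ 2) / 2 := by
    rw [integral_div, integral_add, integral_normSq_sum_torusMonomial]
    · simp [hA, hw]
    · exact (hc.norm.pow 2).integrable_of_hasCompactSupport (HasCompactSupport.of_compactSpace _)
    · exact integrable_const _
  have h5 : A ≤ ‖A‖ := le_abs_self A
  linarith

/-! ### Tensor squares of operators on `L_1` -/

theorem integrable_prod_sum_mul {I α β : Type*} [MeasurableSpace α] [MeasurableSpace β]
    {μ : Measure α} {ν : Measure β} [SFinite μ] [SFinite ν] (s : Finset I) (a : I → ℂ)
    (v : I → Lp ℂ 1 μ) (w : I → Lp ℂ 1 ν) :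
    Integrable (fun z : α × β => ∑ i ∈ s, a i * v i z.1 * w i z.2) (μ.prod ν) :=
  integrable_finsetSum _ fun i _ =>
    ((L1.integrable_coeFn (v i)).const_mul (a i)).mul_prod (L1.integrable_coeFn (w i))

/-- For fixed `t` this is the operator norm bound for `u` in the other variable, integrated over
`t`. -/
theorem integral_integral_norm_apply_le {I α β γ : Type*} [MeasurableSpace α] [MeasurableSpace β]
    [MeasurableSpace γ] {μ : Measure α} {ν : Measure β} {κ : Measure γ} [SFinite μ] [SFinite ν]
    [SFinite κ] (u : Lp ℂ 1 μ →L[ℂ] Lp ℂ 1 ν) (s : Finset I) (a : I → ℂ) (e : I → Lp ℂ 1 μ)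
    (v : I → Lp ℂ 1 κ) :
    ∫ t, ∫ y, ‖∑ i ∈ s, a i * v i t * u (e i) y‖ ∂ν ∂κ ≤
      ‖u‖ * ∫ t, ∫ x, ‖∑ i ∈ s, a i * v i t * e i x‖ ∂μ ∂κ := by
  rw [← integral_const_mul]
  refine integral_mono (integrable_prod_sum_mul s a v fun i => u (e i)).norm.integral_prod_left
    ((integrable_prod_sum_mul s a v e).norm.integral_prod_left.const_mul _) fun t => ?_
  dsimp only
  rw [← norm_sum_smul_eq_integral, ← norm_sum_smul_eq_integral]
  simpa only [map_sum, map_smul] using u.le_opNorm (∑ i ∈ s, (a i * v i t) • e i)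

/-- The tensor square of an operator on `L_1` is bounded by the square of its norm. -/
theorem integral_integral_norm_tensor_le {I α β : Type*} [MeasurableSpace α] [MeasurableSpace β]
    {μ : Measure α} {ν : Measure β} [SFinite μ] [SFinite ν]
    (u : Lp ℂ 1 μ →L[ℂ] Lp ℂ 1 ν) (s : Finset I) (a : I → ℂ) (e : I → Lp ℂ 1 μ) :
    ∫ t, ∫ y, ‖∑ i ∈ s, a i * u (e i) t * u (e i) y‖ ∂ν ∂ν ≤
      ‖u‖ ^ 2 * ∫ t, ∫ x, ‖∑ i ∈ s, a i * e i t * e i x‖ ∂μ ∂μ := by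
  have h1 := integral_integral_norm_apply_le u s a e fun i => u (e i)
  have h2 := integral_integral_norm_apply_le u s a e e
  have h3 : ∫ t, ∫ x, ‖∑ i ∈ s, a i * u (e i) t * e i x‖ ∂μ ∂ν =
      ∫ x, ∫ t, ‖∑ i ∈ s, a i * e i x * u (e i) t‖ ∂ν ∂μ := by
    rw [integral_integral_swap]
    · simp only [mul_right_comm]
    · exact (integrable_prod_sum_mul s a (fun i => u (e i)) e).norm
  rw [h3] at h1
  calc _ ≤ _ := h1
    _ ≤ _ := mul_le_mul_of_nonneg_left h2 (norm_nonneg u)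
    _ = _ := by ring

/-! ### Riesz products -/

theorem Circle.coe_finset_prod {I : Type*} (s : Finset I) (f : I → Circle) :
    ((∏ i ∈ s, f i : Circle) : ℂ) = ∏ i ∈ s, (f i : ℂ) :=
  map_prod Circle.coeHom f s

/-- The Riesz product `∏ n ∈ S, (1 + 2 ρ Re (c_n z_n))`. -/
noncomputable def rieszProduct {S : Finset ℕ} (ρ : ℝ) (c : S → Circle) (θ : InfTorus) : ℝ :=
  ∏ n : S, (1 + 2 * ρ * ((c n * AddCircle.toCircle (θ n) : Circle) : ℂ).re)

/-- The exponents occurring in the Riesz products over `S`. -/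
def rieszSpectrum (S : Finset ℕ) : Finset (S → ℤ) :=
  Fintype.piFinset fun _ => {0, 1, -1}

/-- The Fourier coefficients of the Riesz product. -/
noncomputable def rieszCoeff {S : Finset ℕ} (ρ : ℝ) (c : S → Circle) (p : S → ℤ) : ℂ :=
  ∏ n, (ρ : ℂ) ^ (p n).natAbs * ((c n ^ p n : Circle) : ℂ)

/-- For `w` on the circle, `1 + 2ρ Re w = 1 + ρ w + ρ w⁻¹`; expanding the product selects an
exponent in `{0, 1, -1}` at each coordinate. -/
theorem rieszProduct_eq_sum {S : Finset ℕ} (ρ : ℝ) (c : S → Circle) (θ : InfTorus) :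
    (rieszProduct ρ c θ : ℂ) =
      ∑ p ∈ rieszSpectrum S, rieszCoeff ρ c p * (torusMonomial p θ : ℂ) := by
  have h1 : ∀ n : S, ((1 + 2 * ρ * ((c n * AddCircle.toCircle (θ n) : Circle) : ℂ).re : ℝ) : ℂ) =
      ∑ j ∈ ({0, 1, -1} : Finset ℤ),
        (ρ : ℂ) ^ j.natAbs * (((c n * AddCircle.toCircle (θ n)) ^ j : Circle) : ℂ) := by
    intro n
    generalize c n * AddCircle.toCircle (θ n) = w
    rw [Finset.sum_insert (by decide), Finset.sum_insert (by decide), Finset.sum_singleton]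
    have := Complex.add_conj (w : ℂ)
    simp only [Int.natAbs_zero, pow_zero, zpow_zero, Circle.coe_one, Int.natAbs_one, pow_one,
      zpow_one, Int.natAbs_neg, zpow_neg, Circle.coe_inv_eq_conj]
    push_cast at this ⊢
    linear_combination -(ρ : ℂ) * this
  rw [rieszProduct, Complex.ofReal_prod, Finset.prod_congr rfl fun n _ => h1 n,
    Finset.prod_univ_sum]
  refine Finset.sum_congr rfl fun p _ => ?_
  rw [rieszCoeff, torusMonomial, Circle.coe_finset_prod, ← Finset.prod_mul_distrib]
  refine Finset.prod_congr rfl fun n _ => ?_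
  rw [mul_zpow, Circle.coe_mul, mul_assoc]

theorem rieszProduct_nonneg {S : Finset ℕ} {ρ : ℝ} (h0 : 0 ≤ ρ) (h1 : 2 * ρ ≤ 1)
    (c : S → Circle) (θ : InfTorus) : 0 ≤ rieszProduct ρ c θ := by
  refine Finset.prod_nonneg fun n _ => ?_
  have := (abs_le.1 ((Complex.abs_re_le_norm _).trans
    (Circle.norm_coe (c n * AddCircle.toCircle (θ n))).le)).1
  nlinarith

theorem continuous_rieszProduct {S : Finset ℕ} (ρ : ℝ) (c : S → Circle) :
    Continuous (rieszProduct ρ c) := by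
  have : (rieszProduct ρ c) = fun θ =>
      (∑ p ∈ rieszSpectrum S, rieszCoeff ρ c p * (torusMonomial p θ : ℂ)).re := by
    funext θ
    rw [← rieszProduct_eq_sum, Complex.ofReal_re]
  rw [this]
  exact Complex.continuous_re.comp
    (continuous_finsetSum _ fun p _ => continuous_const.mul (continuous_torusMonomial p))

theorem integral_rieszProduct {S : Finset ℕ} (ρ : ℝ) (c : S → Circle) :
    ∫ θ, rieszProduct ρ c θ ∂torusHaar = 1 := by
  have h : ((∫ θ, rieszProduct ρ c θ ∂torusHaar : ℝ) : ℂ) = 1 := by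
    rw [← integral_complex_ofReal]
    simp_rw [rieszProduct_eq_sum]
    rw [integral_finsetSum _ fun p _ =>
      (memLp_one_iff_integrable.1 (memLp_torusMonomial p)).const_mul _]
    simp_rw [integral_const_mul, integral_torusMonomial]
    simp [rieszSpectrum, rieszCoeff]
  exact_mod_cast h

/-! ### Filtering the Riesz product by degree -/

/-- The imaginary unit, as a point of the circle. -/
noncomputable def circleI : Circle :=
  ⟨Complex.I, by simp [Submonoid.unitSphere]⟩

theorem coe_circleI : (circleI : ℂ) = Complex.I := rfl

theorem rieszCoeff_smul {S : Finset ℕ} (ρ : ℝ) (w : Circle) (c : S → Circle) (p : S → ℤ) :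
    rieszCoeff ρ (fun n => w * c n) p = ((w ^ ∑ n, p n : Circle) : ℂ) * rieszCoeff ρ c p := by
  have : w ^ ∑ n, p n = ∏ n, w ^ p n := by
    induction (Finset.univ : Finset S) using Finset.induction_on with
    | empty => simp
    | insert i s hi ih => rw [Finset.sum_insert hi, Finset.prod_insert hi, zpow_add, ih]
  rw [rieszCoeff, rieszCoeff, this, Circle.coe_finset_prod, ← Finset.prod_mul_distrib]
  refine Finset.prod_congr rfl fun n _ => ?_
  rw [mul_zpow, Circle.coe_mul]
  ring

theorem norm_rieszCoeff {S : Finset ℕ} {ρ : ℝ} (h0 : 0 ≤ ρ) (c : S → Circle) (p : S → ℤ) :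
    ‖rieszCoeff ρ c p‖ = ρ ^ ∑ n, (p n).natAbs := by
  rw [rieszCoeff, norm_prod, ← Finset.prod_pow_eq_pow_sum]
  refine Finset.prod_congr rfl fun n _ => ?_
  rw [norm_mul, Circle.norm_coe, mul_one, norm_pow, Complex.norm_real, Real.norm_of_nonneg h0]

/-- The projection of the degree `d` to the residue class of `1` modulo `4`. -/
noncomputable def degreeFilter (d : ℤ) : ℂ :=
  4⁻¹ * ∑ j ∈ Finset.range 4, (((circleI ^ j) ^ (d - 1) : Circle) : ℂ)

theorem norm_degreeFilter_le (d : ℤ) : ‖degreeFilter d‖ ≤ 1 := by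
  rw [degreeFilter, norm_mul]
  have := norm_sum_le (Finset.range 4) fun j => (((circleI ^ j) ^ (d - 1) : Circle) : ℂ)
  simp only [Circle.norm_coe, Finset.sum_const, Finset.card_range] at this
  norm_num at this ⊢
  linarith

theorem degreeFilter_one : degreeFilter 1 = 1 := by
  simp [degreeFilter]

theorem degreeFilter_zero : degreeFilter 0 = 0 := by
  simp [degreeFilter, Finset.sum_range_succ, coe_circleI, pow_succ]

/-- Separating degree `-1` from degree `1` is why parity would not suffice: the filter must remove
the characters `z_n⁻¹`. -/
theorem degreeFilter_neg_one : degreeFilter (-1) = 0 := by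
  have : (-1 - 1 : ℤ) = -(2 : ℕ) := by norm_num
  rw [degreeFilter, this]
  simp only [zpow_neg, zpow_natCast]
  simp [Finset.sum_range_succ, coe_circleI, pow_succ]

/-- The Fourier coefficients of the average of rotated Riesz products: they equal `c_n` at
the `n`-th coordinate and are at most `ρ` elsewhere. -/
noncomputable def filteredCoeff {S : Finset ℕ} (ρ : ℝ) (c : S → Circle) (p : S → ℤ) : ℂ :=
  (ρ : ℂ)⁻¹ * degreeFilter (∑ n, p n) * rieszCoeff ρ c p

theorem filteredCoeff_single {S : Finset ℕ} {ρ : ℝ} (h0 : 0 < ρ) (c : S → Circle) (n : S) :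
    filteredCoeff ρ c (Pi.single n 1) = c n := by
  have h1 : ∑ k, (Pi.single n 1 : S → ℤ) k = 1 := by simp
  have h2 : rieszCoeff ρ c (Pi.single n 1) = ρ * c n := by
    rw [rieszCoeff, Finset.prod_eq_single n]
    · simp
    · intro k _ hk
      simp [hk]
    · simp
  have : (ρ : ℂ) ≠ 0 := by exact_mod_cast h0.ne'
  rw [filteredCoeff, h1, degreeFilter_one, h2]
  field_simp

theorem eq_single_of_sum_natAbs_eq_one {ι : Type*} [Fintype ι] [DecidableEq ι] {p : ι → ℤ}
    (h : ∑ n, (p n).natAbs = 1) : ∃ n, p = Pi.single n 1 ∨ p = Pi.single n (-1) := by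
  have h1 : ∃ n, p n ≠ 0 := by
    by_contra! h'
    simp [h'] at h
  obtain ⟨n, hn⟩ := h1
  have h2 := Finset.add_sum_erase Finset.univ (fun k => (p k).natAbs) (Finset.mem_univ n)
  have h3 : ∑ k ∈ Finset.univ.erase n, (p k).natAbs = 0 := by
    omega
  have h4 : ∀ k, k ≠ n → p k = 0 := fun k hk => by
    simpa using Finset.sum_eq_zero_iff.1 h3 k (by simp [hk])
  have h5 : p = Pi.single n (p n) := by
    funext k
    by_cases hk : k = n
    · subst hk
      simp
    · simp [hk, h4 k hk]
  have h6 : p n = 1 ∨ p n = -1 := by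
    omega
  refine ⟨n, ?_⟩
  rcases h6 with h6 | h6
  · exact Or.inl (h6 ▸ h5)
  · exact Or.inr (h6 ▸ h5)

/-- The filter kills the constant and the `z_n⁻¹`. All other exponents have `∑ |p_n| ≥ 2`, so
dividing `ρ ^ ∑ |p_n|` by `ρ` still leaves at most `ρ`. -/
theorem norm_filteredCoeff_le {S : Finset ℕ} {ρ : ℝ} (h0 : 0 < ρ) (h1 : ρ ≤ 1) (c : S → Circle)
    {p : S → ℤ} (hp : ∀ n, p ≠ Pi.single n 1) : ‖filteredCoeff ρ c p‖ ≤ ρ := by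
  have hz : degreeFilter (∑ n, p n) = 0 → ‖filteredCoeff ρ c p‖ ≤ ρ := fun h => by
    rw [filteredCoeff, h, mul_zero, zero_mul, norm_zero]
    exact h0.le
  rcases Nat.lt_or_ge (∑ n, (p n).natAbs) 2 with h | h
  · rcases Nat.lt_or_ge (∑ n, (p n).natAbs) 1 with h' | h'
    · have h3 : ∑ n, (p n).natAbs = 0 := by omega
      have h4 : ∀ k, p k = 0 := fun k => by
        simpa using Finset.sum_eq_zero_iff.1 h3 k (Finset.mem_univ k)
      exact hz (by simp [h4, degreeFilter_zero])
    · obtain ⟨n, hn | hn⟩ := eq_single_of_sum_natAbs_eq_one (le_antisymm (by omega) h')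
      · exact absurd hn (hp n)
      · exact hz (by simp [hn, degreeFilter_neg_one])
  · rw [filteredCoeff, norm_mul, norm_mul, norm_rieszCoeff h0.le, norm_inv, Complex.norm_real,
      Real.norm_of_nonneg h0.le]
    calc ρ⁻¹ * ‖degreeFilter (∑ n, p n)‖ * ρ ^ ∑ n, (p n).natAbs ≤ ρ⁻¹ * 1 * ρ ^ 2 := by
          gcongr ρ⁻¹ * ?_ * ?_
          · exact norm_degreeFilter_le _
          · exact pow_le_pow_of_le_one h0.le h1 h
      _ = ρ := by field_simp

theorem sum_filteredCoeff_mul {S : Finset ℕ} (ρ : ℝ) (c : S → Circle) (θ : InfTorus) :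
    ∑ p ∈ rieszSpectrum S, filteredCoeff ρ c p * (torusMonomial p θ : ℂ) =
      ∑ j ∈ Finset.range 4, (ρ : ℂ)⁻¹ * 4⁻¹ * ((circleI ^ j : Circle) : ℂ)⁻¹ *
        (rieszProduct ρ (fun n => circleI ^ j * c n) θ : ℂ) := by
  simp_rw [rieszProduct_eq_sum, Finset.mul_sum]
  rw [Finset.sum_comm]
  refine Finset.sum_congr rfl fun p _ => ?_
  simp_rw [rieszCoeff_smul, filteredCoeff, degreeFilter, Finset.mul_sum, Finset.sum_mul]
  refine Finset.sum_congr rfl fun j _ => ?_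
  rw [zpow_sub_one, Circle.coe_mul, Circle.coe_inv]
  ring

/-- Up to unimodular factors the polynomial is `ρ⁻¹` times an average of four Riesz products, each
nonnegative with integral one. -/
theorem integral_norm_sum_filteredCoeff_le {S : Finset ℕ} {ρ : ℝ} (h0 : 0 < ρ) (h1 : 2 * ρ ≤ 1)
    (c : S → Circle) :
    ∫ θ, ‖∑ p ∈ rieszSpectrum S, filteredCoeff ρ c p * (torusMonomial p θ : ℂ)‖ ∂torusHaar ≤
      ρ⁻¹ := by
  have hi : ∀ j : ℕ, Integrable (fun θ => ρ⁻¹ * 4⁻¹ *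
      rieszProduct ρ (fun n => circleI ^ j * c n) θ) torusHaar := fun j =>
    ((continuous_rieszProduct ρ _).integrable_of_hasCompactSupport
      (HasCompactSupport.of_compactSpace _)).const_mul _
  have hc : Continuous fun θ =>
      ∑ p ∈ rieszSpectrum S, filteredCoeff ρ c p * (torusMonomial p θ : ℂ) :=
    continuous_finsetSum _ fun p _ => continuous_const.mul (continuous_torusMonomial p)
  calc _ ≤ ∫ θ, ∑ j ∈ Finset.range 4, ρ⁻¹ * 4⁻¹ *
        rieszProduct ρ (fun n => circleI ^ j * c n) θ ∂torusHaar := by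
        refine integral_mono (hc.norm.integrable_of_hasCompactSupport
          (HasCompactSupport.of_compactSpace _)) (integrable_finsetSum _ fun j _ => hi j)
          fun θ => ?_
        dsimp only
        rw [sum_filteredCoeff_mul]
        refine (norm_sum_le _ _).trans (Finset.sum_le_sum fun j _ => le_of_eq ?_)
        rw [norm_mul, norm_mul, norm_mul, norm_inv, norm_inv, norm_inv, Circle.norm_coe,
          Complex.norm_real, Complex.norm_real, Real.norm_of_nonneg h0.le,
          Real.norm_of_nonneg (rieszProduct_nonneg h0.le h1 _ _)]
        norm_num
    _ = ρ⁻¹ := by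
        rw [integral_finsetSum _ fun j _ => hi j]
        simp_rw [integral_const_mul, integral_rieszProduct]
        rw [Finset.sum_const, Finset.card_range]
        simp
        ring

/-! ### The kernel and its pairing with tensor squares -/

/-- The kernel depends only on `t + x`, so the inner integral is independent of `t`. -/
theorem integral_integral_norm_kernel {S : Finset ℕ} (P : Finset (S → ℤ)) (a : (S → ℤ) → ℂ) :
    ∫ t, ∫ x, ‖∑ p ∈ P, a p * torusMonomialLp p t * torusMonomialLp p x‖ ∂torusHaar ∂torusHaar =
      ∫ θ, ‖∑ p ∈ P, a p * (torusMonomial p θ : ℂ)‖ ∂torusHaar := by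
  have : ∀ᵐ t ∂torusHaar, ∀ p ∈ P, torusMonomialLp p t = (torusMonomial p t : ℂ) :=
    (Filter.eventually_all_finset P).2 fun p _ => coeFn_torusMonomialLp p
  have h : ∀ᵐ t ∂torusHaar,
      ∫ x, ‖∑ p ∈ P, a p * torusMonomialLp p t * torusMonomialLp p x‖ ∂torusHaar =
        ∫ θ, ‖∑ p ∈ P, a p * (torusMonomial p θ : ℂ)‖ ∂torusHaar := by
    filter_upwards [this] with t ht
    rw [← norm_sum_smul_eq_integral, norm_sum_smul_torusMonomialLp,
      ← integral_add_left_eq_self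
        (fun θ => ‖∑ p ∈ P, a p * (torusMonomial p θ : ℂ)‖) t]
    congr 1
    funext x
    congr 1
    refine Finset.sum_congr rfl fun p hp => ?_
    rw [ht p hp, torusMonomial_add, Circle.coe_mul, mul_assoc]
  rw [integral_congr_ae h]
  simp

theorem ae_norm_le_norm_of_top {α : Type*} [MeasurableSpace α] {μ : Measure α}
    (φ : Lp ℂ ⊤ μ) : ∀ᵐ x ∂μ, ‖φ x‖ ≤ ‖φ‖ := by
  filter_upwards [ae_le_eLpNormEssSup (f := φ) (μ := μ)] with x hx
  rw [← eLpNorm_exponent_top, ← Lp.enorm_def] at hx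
  simpa [enorm_le_iff_norm_le] using hx

theorem norm_integral_mul_le {α : Type*} [MeasurableSpace α] {μ : Measure α}
    (φ : Lp ℂ ⊤ μ) {F : α → ℂ} (hF : Integrable F μ) :
    ‖∫ x, φ x * F x ∂μ‖ ≤ ‖φ‖ * ∫ x, ‖F x‖ ∂μ := by
  rw [← integral_const_mul]
  refine norm_integral_le_of_norm_le (hF.norm.const_mul _) ?_
  filter_upwards [ae_norm_le_norm_of_top φ] with x hx
  rw [norm_mul]
  gcongr

/-- The bilinear pairing with an element of `L_∞`, as a functional on `L_1`. -/
noncomputable def pairingLp {α : Type*} [MeasurableSpace α] {μ : Measure α}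
    (φ : Lp ℂ ⊤ μ) : Lp ℂ 1 μ →L[ℂ] ℂ :=
  (ContinuousLinearMap.mul ℂ ℂ).lpPairing μ ⊤ 1 φ

theorem pairingLp_apply {α : Type*} [MeasurableSpace α] {μ : Measure α}
    (φ : Lp ℂ ⊤ μ) (g : Lp ℂ 1 μ) : pairingLp φ g = ∫ x, φ x * g x ∂μ := by
  rw [pairingLp, ContinuousLinearMap.lpPairing_eq_integral]
  rfl

theorem norm_pairingLp_apply_le {α : Type*} [MeasurableSpace α] {μ : Measure α}
    (φ : Lp ℂ ⊤ μ) (g : Lp ℂ 1 μ) : ‖pairingLp φ g‖ ≤ ‖φ‖ * ‖g‖ := by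
  rw [pairingLp_apply, L1.norm_eq_integral_norm]
  exact norm_integral_mul_le φ (L1.integrable_coeFn g)

theorem integral_tensorSquare_mul {α I J : Type*} [MeasurableSpace α] {μ : Measure α}
    [IsProbabilityMeasure μ] (s : Finset I) (x : I → ℂ) (ψ : I → Lp ℂ ⊤ μ)
    (P : Finset J) (a : J → ℂ) (g : J → Lp ℂ 1 μ) :
    ∫ z, (∑ n ∈ s, x n • tensorSquare (ψ n) : Lp ℂ ⊤ (μ.prod μ)) z *
        ∑ p ∈ P, a p * g p z.1 * g p z.2 ∂(μ.prod μ) =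
      ∑ n ∈ s, x n * ∑ p ∈ P, a p * pairingLp (ψ n) (g p) ^ 2 := by
  have h1 : ∀ᵐ z ∂(μ.prod μ), ∀ n ∈ s, tensorSquare (ψ n) z = ψ n z.1 * ψ n z.2 :=
    (Filter.eventually_all_finset s).2 fun n _ => (memLp_tensorSquare (ψ n)).coeFn_toLp
  have h2 : ∀ᵐ z ∂(μ.prod μ), (∑ n ∈ s, x n • tensorSquare (ψ n) : Lp ℂ ⊤ (μ.prod μ)) z *
        ∑ p ∈ P, a p * g p z.1 * g p z.2 =
      ∑ n ∈ s, ∑ p ∈ P, (x n * a p) * ((ψ n z.1 * g p z.1) * (ψ n z.2 * g p z.2)) := by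
    filter_upwards [h1, coeFn_sum_smul s x fun n => tensorSquare (ψ n)] with z hz h
    rw [h, Finset.sum_mul_sum]
    refine Finset.sum_congr rfl fun n hn => Finset.sum_congr rfl fun p _ => ?_
    rw [hz n hn]
    ring
  have hi : ∀ n p, Integrable (fun t => ψ n t * g p t) μ := fun n p =>
    (L1.integrable_coeFn (g p)).bdd_mul (Lp.aestronglyMeasurable (ψ n))
      (ae_norm_le_norm_of_top (ψ n))
  have hi2 : ∀ n p, Integrable (fun z : α × α =>
      (x n * a p) * ((ψ n z.1 * g p z.1) * (ψ n z.2 * g p z.2))) (μ.prod μ) := fun n p =>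
    ((hi n p).mul_prod (hi n p)).const_mul _
  rw [integral_congr_ae h2,
    integral_finsetSum _ fun n _ => integrable_finsetSum _ fun p _ => hi2 n p]
  refine Finset.sum_congr rfl fun n _ => ?_
  rw [integral_finsetSum _ fun p _ => hi2 n p, Finset.mul_sum]
  refine Finset.sum_congr rfl fun p _ => ?_
  rw [integral_const_mul, integral_prod_mul (fun t => ψ n t * g p t) (fun t => ψ n t * g p t),
    pairingLp_apply]
  ring

/-! ### Error estimate and conclusion -/

theorem norm_sum_filteredCoeff_sub_le {S : Finset ℕ} {ρ : ℝ} (h0 : 0 < ρ) (h1 : ρ ≤ 1)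
    (c : S → Circle) (n : S) (v : (S → ℤ) → ℂ) (hn : v (Pi.single n 1) = 1)
    (hv : ∀ k, k ≠ n → v (Pi.single k 1) = 0) :
    ‖∑ p ∈ rieszSpectrum S, filteredCoeff ρ c p * v p ^ 2 - c n‖ ≤
      ρ * ∑ p ∈ rieszSpectrum S, ‖v p‖ ^ 2 := by
  have hmem : (Pi.single n 1 : S → ℤ) ∈ rieszSpectrum S := by
    rw [rieszSpectrum, Fintype.mem_piFinset]
    intro k
    by_cases hk : k = n
    · subst hk
      simp
    · simp [hk]
  have h2 : (c n : ℂ) = ∑ p ∈ rieszSpectrum S, if p = Pi.single n 1 then (c n : ℂ) else 0 := by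
    rw [Finset.sum_ite_eq', if_pos hmem]
  rw [h2, ← Finset.sum_sub_distrib, Finset.mul_sum]
  refine (norm_sum_le _ _).trans (Finset.sum_le_sum fun p _ => ?_)
  have h3 : 0 ≤ ρ * ‖v p‖ ^ 2 := by positivity
  by_cases hp : ∃ k, p = Pi.single k 1
  · obtain ⟨k, rfl⟩ := hp
    by_cases hk : k = n
    · subst hk
      simpa [filteredCoeff_single h0, hn] using h0.le
    · have : (Pi.single k 1 : S → ℤ) ≠ Pi.single n 1 := fun h => by
        have := congrFun h k
        simp [hk] at this
      rw [if_neg this, hv k hk] at *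
      simp
  · push Not at hp
    rw [if_neg (hp n), sub_zero, norm_mul, norm_pow]
    gcongr
    exact norm_filteredCoeff_le h0 h1 c hp

theorem exists_circle_mul_eq_norm (z : ℂ) : ∃ w : Circle, z * w = ‖z‖ := by
  refine ⟨Circle.exp (-z.arg), ?_⟩
  conv_lhs => rw [← Complex.norm_mul_exp_arg_mul_I z]
  rw [Circle.coe_exp, mul_assoc, ← Complex.exp_add]
  simp

theorem mainTheorem5 {T : Type*} [MeasurableSpace T] (m : Measure T) [IsProbabilityMeasure m]
    (f : ℕ → Lp ℂ 1 m) (hf : IsDominated f steinhaus)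
    (ψ : ℕ → Lp ℂ ⊤ m) (hbdd : ∃ K : ℝ, ∀ n, ‖ψ n‖ ≤ K) (hbi : IsBiorthogonal ψ f) :
    IsTensorSquareSidon ψ := by
  obtain ⟨-, u, -, hu⟩ := hf
  obtain ⟨K, hK⟩ := hbdd
  set M : ℝ := K * ‖u‖ with hM
  -- This choice secures both `2ρ ≤ 1`, for positivity of the Riesz products, and `ρ M² ≤ 1/2`, for
  -- the error term.
  set ρ : ℝ := (2 + 2 * M ^ 2)⁻¹ with hρ
  have hpos : 0 < 2 + 2 * M ^ 2 := by positivity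
  have h0 : 0 < ρ := inv_pos.2 hpos
  have hρ1 : ρ * (2 + 2 * M ^ 2) = 1 := inv_mul_cancel₀ hpos.ne'
  have h1 : 2 * ρ ≤ 1 := by nlinarith [mul_nonneg h0.le (sq_nonneg M)]
  have h2 : ρ * M ^ 2 ≤ 1 / 2 := by nlinarith
  refine ⟨2 * (‖u‖ ^ 2 * ρ⁻¹), fun x => ?_⟩
  choose c hc using fun n => exists_circle_mul_eq_norm (x n)
  set S := x.support
  set a : (S → ℤ) → ℂ := filteredCoeff ρ fun n => c n
  set g : (S → ℤ) → Lp ℂ 1 m := fun p => u (torusMonomialLp p)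
  set Φ := ∑ n ∈ S, x n • tensorSquare (ψ n)
  have hint := integrable_prod_sum_mul (rieszSpectrum S) a g g
  have hup : ‖∑ n ∈ S, x n * ∑ p ∈ rieszSpectrum S, a p * pairingLp (ψ n) (g p) ^ 2‖ ≤
      ‖Φ‖ * (‖u‖ ^ 2 * ρ⁻¹) := by
    rw [← integral_tensorSquare_mul]
    refine (norm_integral_mul_le Φ hint).trans (mul_le_mul_of_nonneg_left ?_ (norm_nonneg _))
    rw [integral_prod _ hint.norm]
    refine (integral_integral_norm_tensor_le u _ a torusMonomialLp).trans ?_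
    rw [integral_integral_norm_kernel]
    gcongr
    exact integral_norm_sum_filteredCoeff_le h0 h1 _
  have herr : ∀ n ∈ S,
      ‖∑ p ∈ rieszSpectrum S, a p * pairingLp (ψ n) (g p) ^ 2 - c n‖ ≤ 1 / 2 := by
    intro n hn
    have hg : ∀ k : S, g (Pi.single k 1) = f k := fun k => by
      simp only [g]
      rw [torusMonomialLp_single, hu]
    refine (norm_sum_filteredCoeff_sub_le h0 (by linarith) (fun n : S => c n) ⟨n, hn⟩
      (fun p => pairingLp (ψ n) (g p)) ?_ ?_).trans (le_trans ?_ h2)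
    · rw [hg, pairingLp_apply, hbi.1]
    · intro k hk
      rw [hg, pairingLp_apply, hbi.2]
      exact fun h => hk (Subtype.ext h.symm)
    · refine mul_le_mul_of_nonneg_left ?_ h0.le
      refine sum_normSq_apply_torusMonomialLp_le _
        ((pairingLp (ψ n)).comp u).toLinearMap fun e => ?_
      calc ‖pairingLp (ψ n) (u e)‖ ≤ ‖ψ n‖ * ‖u e‖ := norm_pairingLp_apply_le _ _
        _ ≤ K * (‖u‖ * ‖e‖) :=
            mul_le_mul (hK n) (u.le_opNorm e) (norm_nonneg _) ((norm_nonneg _).trans (hK n))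
        _ = M * ‖e‖ := by rw [hM]; ring
  have hsplit : ((∑ n ∈ S, ‖x n‖ : ℝ) : ℂ) =
      ∑ n ∈ S, x n * ∑ p ∈ rieszSpectrum S, a p * pairingLp (ψ n) (g p) ^ 2 -
        ∑ n ∈ S, x n * (∑ p ∈ rieszSpectrum S, a p * pairingLp (ψ n) (g p) ^ 2 - c n) := by
    rw [← Finset.sum_sub_distrib]
    push_cast
    refine Finset.sum_congr rfl fun n _ => ?_
    rw [← hc n]
    ring
  have herr2 : ‖∑ n ∈ S, x n *
      (∑ p ∈ rieszSpectrum S, a p * pairingLp (ψ n) (g p) ^ 2 - c n)‖ ≤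
        (∑ n ∈ S, ‖x n‖) * (1 / 2) := by
    rw [Finset.sum_mul]
    refine (norm_sum_le _ _).trans (Finset.sum_le_sum fun n hn => ?_)
    rw [norm_mul]
    exact mul_le_mul_of_nonneg_left (herr n hn) (norm_nonneg _)
  have h3 := congrArg norm hsplit
  rw [Complex.norm_real, Real.norm_of_nonneg (Finset.sum_nonneg fun n _ => norm_nonneg _)] at h3
  have h4 := h3.le.trans (norm_sub_le _ _)
  change ∑ n ∈ S, ‖x n‖ ≤ 2 * (‖u‖ ^ 2 * ρ⁻¹) * ‖Φ‖
  -- The error `(1/2) ∑ |x_n|` is absorbed on the left, whence the factor `2` in the constant.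
  linarith
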